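/- Index sequences by $\mathbb N=\{1,2,\dots\}$. For $\varepsilon,\sigma>0$, $\theta\in\ell^2(\mathbb N)$ and a positive sequence $b=(b_j)$, let $\mathbb P_{\theta,b}$ be the joint law of the observations $Y_j=b_j\theta_j+\varepsilon\xi_j$, $X_j=b_j+\sigma\eta_j$, $j\in\mathbb N$, where all the $\xi_j,\eta_j$ are independent standard Gaussian variables. Let $a=(a_j)$ be a non-decreasing sequence of positive reals tending to infinity, $\mathcal E_a=\{\theta\in\ell^2(\mathbb N):\sum_j a_j^2\theta_j^2\le 1\}$, and $\Theta_a(r)=\{\theta\in\mathcal E_a:\|\theta\|\ge r\}$. Let $\mathcal B$ be a set of positive sequences, the possible values of the unknown $b$ (it may be a single sequence). A test $\Psi$ assigns to each known benchmark $\theta_0$ a measurable function $\Psi_{\theta_0}$ of $(Y,X)$ with values in $\{0,1\}$. It has level $\alpha$ if $\mathbb P_{\theta_0,b}(\Psi_{\theta_0}=1)\le\alpha$ for all $\theta_0\in\mathcal E_a$ and $b\in\mathcal B$. Its separation radius is the infimum of the $r>0$ such that $\mathbb P_{\theta,b}(\Psi_{\theta_0}=0)\le\beta$ for all $b\in\mathcal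 B$, $\theta_0\in\mathcal E_a$ and $\theta$ with $\theta-\theta_0\in\Theta_a(r)$. The minimax separation radius $\tilde r_{\varepsilon,\sigma}$ is the infimum of the separation radii of all tests of level $\alpha$. For sequences, $c_j\sim d_j$ means that $\kappa_0\le c_j/d_j\le\kappa_1$ for all $j\in\mathbb N$, with constants $0<\kappa_0\le\kappa_1<\infty$; "$b_j\sim d_j$ on $\mathcal B$" means that this holds for all $b\in\mathcal B$ with common constants. Theorem. Let $\alpha,\beta\in(0,1)$ and $s,t>0$. In each of the following four cases there are $\varepsilon_0,\sigma_0\in(0,1)$ and $C>0$ such that, for all $0<\varepsilon\le\varepsilon_0$ and $0<\sigma\le\sigma_0$, the stated bound holds. (i) If $b_j\sim j^{-t}$ on $\mathcal B$ and $a_j\sim j^{s}$, then $$\tilde r_{\varepsilon,\sigma}^2\le C\Big(\varepsilon^{\frac{4s}{2s+2t+1/2}}\vee\big[\sigma\ln^{3/4}(1/\sigma)\big]^{2(\frac st\wedge1)}\Big).$$ (ii) If $b_j\sim j^{-t}$ on $\mathcal B$ and $a_j\sim e^{js}$, then $$\tilde r_{\varepsilon,\sigma}^2\le C\Big(\varepsilon^2[\ln(1/\varepsilon)]^{2t+1/2}\vee\sigma^2\ln^{3/2}(1/\sigma)\Big).$$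 (iii) If $b_j\sim e^{-jt}$ on $\mathcal B$ and $a_j\sim j^{s}$, then $$\tilde r_{\varepsilon,\sigma}^2\le C\bigg([\ln(1/\varepsilon)]^{-2s}\vee\Big[\ln\Big(\frac1{\sigma\ln^{1/2}(1/\sigma)}\Big)\Big]^{-2s}\bigg).$$ (iv) If $b_j\sim e^{-jt}$ on $\mathcal B$ and $a_j\sim e^{js}$, then $$\tilde r_{\varepsilon,\sigma}^2\le C\Big(\varepsilon^{\frac{2s}{s+t}}\vee\big[\sigma\ln^{1/2}(1/\sigma)\big]^{2(\frac st\wedge1)}\Big).$$ -/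

import Mathlib

open MeasureTheory ProbabilityTheory Set Filter Topology
open scoped ENNReal NNReal

noncomputable section

namespace GSM

/-- Square-summable real sequences indexed by `{1, 2, …}`, with their Hilbert norm. -/
abbrev L2 : Type := lp (fun _ : ℕ+ => ℝ) 2

/-- The space of observations `(Y, X) = ((Y_j)_j, (X_j)_j)`. -/
abbrev Obs : Type := (ℕ+ → ℝ) × (ℕ+ → ℝ)

/-- The law of the noise `(ξ, η)`: all the coordinates are independent standard Gaussians. -/
def noise : Measure Obs :=
  (Measure.infinitePi fun _ : ℕ+ => gaussianReal 0 1).prod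
    (Measure.infinitePi fun _ : ℕ+ => gaussianReal 0 1)

/-- The observations produced by the noise `(ξ, η)`:
`Y_j = b_j θ_j + ε ξ_j` and `X_j = b_j + σ η_j`. -/
def observe (ε σ : ℝ) (θ : L2) (b : ℕ+ → ℝ) (ω : Obs) : Obs :=
  (fun j => b j * θ j + ε * ω.1 j, fun j => b j + σ * ω.2 j)

/-- The joint law `P_{θ,b}` of the observations at the noise levels `ε, σ`. -/
def law (ε σ : ℝ) (θ : L2) (b : ℕ+ → ℝ) : Measure Obs :=
  noise.map (observe ε σ θ b)

/-- A smoothness sequence: positive, non-decreasing, and tending to infinity. -/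
structure IsSmoothness (a : ℕ+ → ℝ) : Prop where
  pos : ∀ j, 0 < a j
  mono : Monotone a
  tendsto : Tendsto a atTop atTop

/-- The ellipsoid `{θ ∈ ℓ² : ∑ a_j² θ_j² ≤ 1}`. -/
def ellipsoid (a : ℕ+ → ℝ) : Set L2 :=
  {θ | Summable (fun j => a j ^ 2 * θ j ^ 2) ∧ ∑' j, a j ^ 2 * θ j ^ 2 ≤ 1}

/-- The ellipsoid with the ball of radius `r` removed. -/
def separated (a : ℕ+ → ℝ) (r : ℝ) : Set L2 :=
  {θ | θ ∈ ellipsoid a ∧ r ≤ ‖θ‖}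

/-- A non-randomized test of `θ = θ₀`. The benchmark `θ₀` is known, so the test may use it; the
singular values `b` are unknown, so the test sees them only through the observations.
The value `1` means that the null hypothesis is rejected. -/
structure Test where
  toFun : L2 → Obs → Fin 2
  measurable : ∀ θ₀, Measurable (toFun θ₀)

/-- `Ψ` has level `α` when the unknown `b` ranges over `B`: for every benchmark in the ellipsoid,
the first kind error probability is at most `α`. -/
def HasLevel (a : ℕ+ → ℝ) (B : Set (ℕ+ → ℝ)) (ε σ α : ℝ) (Ψ : Test) : Prop :=
  ∀ θ₀ ∈ ellipsoid a, ∀ b ∈ B, law ε σ θ₀ b {x | Ψ.toFun θ₀ x = 1} ≤ ENNReal.ofReal α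

/-- The maximal second kind error probability of `Ψ` at the radius `r`. -/
def secondKindError (a : ℕ+ → ℝ) (B : Set (ℕ+ → ℝ)) (ε σ r : ℝ) (Ψ : Test) : ℝ≥0∞ :=
  ⨆ (θ₀ : L2) (θ : L2) (b : ℕ+ → ℝ) (_ : θ₀ ∈ ellipsoid a) (_ : θ - θ₀ ∈ separated a r)
    (_ : b ∈ B), law ε σ θ b {x | Ψ.toFun θ₀ x = 0}

/-- The separation radius of `Ψ`: the infimum of the `r > 0` at which the maximal second kind
error probability is at most `β`. -/
def separationRadius (a : ℕ+ → ℝ) (B : Set (ℕ+ → ℝ)) (ε σ β : ℝ) (Ψ : Test) : ℝ≥0∞ :=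
  ⨅ (r : ℝ) (_ : 0 < r) (_ : secondKindError a B ε σ r Ψ ≤ ENNReal.ofReal β), ENNReal.ofReal r

/-- The minimax separation radius: the infimum of the separation radii of the level-`α` tests. -/
def minimaxRadius (a : ℕ+ → ℝ) (B : Set (ℕ+ → ℝ)) (α β ε σ : ℝ) : ℝ≥0∞ :=
  ⨅ (Ψ : Test) (_ : HasLevel a B ε σ α Ψ), separationRadius a B ε σ β Ψ

/-- `c_j ∼ d_j` for all the sequences `c ∈ S`, with common constants. -/
def EquivOn (S : Set (ℕ+ → ℝ)) (d : ℕ+ → ℝ) : Prop :=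
  ∃ κ₀ κ₁ : ℝ, 0 < κ₀ ∧ κ₀ ≤ κ₁ ∧ ∀ c ∈ S, ∀ j, κ₀ ≤ c j / d j ∧ c j / d j ≤ κ₁

/-- `c_j ∼ d_j`: the ratio stays between two positive constants. -/
def SeqEquiv (c d : ℕ+ → ℝ) : Prop :=
  ∃ κ₀ κ₁ : ℝ, 0 < κ₀ ∧ κ₀ ≤ κ₁ ∧ ∀ j, κ₀ ≤ c j / d j ∧ c j / d j ≤ κ₁

/-- For all small enough noise levels, the squared minimax separation radius is at most a constant
times `rate ε σ`. -/
def HasUpperRate (a : ℕ+ → ℝ) (B : Set (ℕ+ → ℝ)) (α β : ℝ) (rate : ℝ → ℝ → ℝ) : Prop :=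
  ∃ ε₀ ∈ Ioo (0 : ℝ) 1, ∃ σ₀ ∈ Ioo (0 : ℝ) 1, ∃ C : ℝ, 0 < C ∧
    ∀ ε σ : ℝ, 0 < ε → ε ≤ ε₀ → 0 < σ → σ ≤ σ₀ →
      minimaxRadius a B α β ε σ ^ 2 ≤ ENNReal.ofReal (C * rate ε σ)

end GSM

end

noncomputable section

namespace GSM

/-! The unknown `b` is removed by testing on the residuals `Y_j - θ₀_j X_j = b_j (θ - θ₀)_j + ε ξ_j
- σ θ₀_j η_j`. They are independent Gaussians whose variances `ε² + σ² θ₀_j²` are known, and the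
same under the null and the alternative; only their means depend on `b`. With weights `d_j⁻²`, where
`b_j ∼ d_j`, the centred sum of squares over `j ≤ D` has mean `∑ (b_j / d_j)² (θ - θ₀)_j²`,
comparable from below with the squared norm of the truncated difference.

Chebyshev's inequality (`noise_quadStat_gt_le`, `noise_quadStat_le_le`) then gives, in
`exists_minimaxRadius_sq_le`, a squared radius of order `a_D⁻² + ε² P + σ² Q`, with `P` a bound for
`(∑_{j ≤ D} d_j⁻⁴)^(1/2)` and `Q` one for `max_{j ≤ D} (a_j d_j)⁻²`. The last term carries no
dimension factor, since `θ₀` lies in the ellipsoid (`sum_noise_level_sq_le`).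

Each of the four rates follows from a choice of `D` balancing the three terms. The logarithmic
factors attached to `σ` are never needed: they only enlarge the bound. -/

/-! ### Independence and Gaussian law of the residual noise -/

instance isProbabilityMeasure_noise : IsProbabilityMeasure noise := by
  unfold noise; infer_instance

lemma measurable_observe (ε σ : ℝ) (θ : L2) (b : ℕ+ → ℝ) : Measurable (observe ε σ θ b) := by
  unfold observe; fun_prop

/-- All the coordinates of the noise, indexed by one type. -/
def coord : ℕ+ ⊕ ℕ+ → Obs → ℝ :=
  Sum.elim (fun j ω => ω.1 j) (fun j ω => ω.2 j)

lemma measurable_coord (i : ℕ+ ⊕ ℕ+) : Measurable (coord i) := by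
  cases i <;> simp only [coord, Sum.elim_inl, Sum.elim_inr] <;> fun_prop

lemma measurePreserving_coord (i : ℕ+ ⊕ ℕ+) :
    MeasurePreserving (coord i) noise (gaussianReal 0 1) := by
  cases i with
  | inl j =>
    exact (measurePreserving_eval_infinitePi (fun _ : ℕ+ => gaussianReal 0 1) j).comp
      measurePreserving_fst
  | inr j =>
    exact (measurePreserving_eval_infinitePi (fun _ : ℕ+ => gaussianReal 0 1) j).comp
      measurePreserving_snd

/-- A finite set of indices splits into its two halves, so the event is a rectangle for the product
of the two infinite product measures. -/
lemma iIndepFun_coord : iIndepFun coord noise := by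
  classical
  rw [iIndepFun_iff_measure_inter_preimage_eq_mul]
  intro S A hA
  have hset : (⋂ i ∈ S, coord i ⁻¹' A i) =
      ((S.toLeft : Set ℕ+).pi fun j => A (Sum.inl j)) ×ˢ
        ((S.toRight : Set ℕ+).pi fun j => A (Sum.inr j)) := by
    ext ω
    simp [coord, Set.mem_pi]
  have hprod : ∀ i ∈ S, noise (coord i ⁻¹' A i) = gaussianReal 0 1 (A i) := fun i hi =>
    (measurePreserving_coord i).measure_preimage (hA i hi).nullMeasurableSet
  rw [hset, Finset.prod_congr rfl hprod, noise, Measure.prod_prod, Measure.infinitePi_pi,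
    Measure.infinitePi_pi]
  · conv_rhs => rw [← Finset.toLeft_disjSum_toRight (u := S)]
    rw [Finset.prod_disjSum]
  · intro j hj; exact hA _ (by simpa using hj)
  · intro j hj; exact hA _ (by simpa using hj)

/-- The centred part `ε ξ_j - c_j η_j` of the residual. -/
def residualNoise (ε : ℝ) (c : ℕ+ → ℝ) (j : ℕ+) (ω : Obs) : ℝ := ε * ω.1 j - c j * ω.2 j

lemma measurable_residualNoise (ε : ℝ) (c : ℕ+ → ℝ) (j : ℕ+) :
    Measurable (residualNoise ε c j) := by
  unfold residualNoise; fun_prop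

lemma indepFun_residualNoise (ε : ℝ) (c : ℕ+ → ℝ) {i j : ℕ+} (hij : i ≠ j) :
    IndepFun (residualNoise ε c i) (residualNoise ε c j) noise := by
  have h := iIndepFun_coord.indepFun_prodMk_prodMk measurable_coord
    (Sum.inl i) (Sum.inr i) (Sum.inl j) (Sum.inr j) (by simpa) (by simp) (by simp) (by simpa)
  exact h.comp (φ := fun p : ℝ × ℝ => ε * p.1 - c i * p.2)
    (ψ := fun p : ℝ × ℝ => ε * p.1 - c j * p.2) (by fun_prop) (by fun_prop)

/-- The law is written as a scaled standard Gaussian so that every later moment reduces to one of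
`gaussianReal 0 1`. -/
lemma map_residualNoise (ε : ℝ) (c : ℕ+ → ℝ) (j : ℕ+) :
    noise.map (residualNoise ε c j) =
      (gaussianReal 0 1).map fun x => √(ε ^ 2 + c j ^ 2) * x := by
  have h : IndepFun (fun ω : Obs => ε * ω.1 j) (fun ω : Obs => (-c j) * ω.2 j) noise :=
    (iIndepFun_coord.indepFun (i := Sum.inl j) (j := Sum.inr j) (by simp)).comp
      (φ := fun x : ℝ => ε * x) (ψ := fun x : ℝ => (-c j) * x) (by fun_prop) (by fun_prop)
  have h1 : noise.map (fun ω : Obs => ε * ω.1 j) = gaussianReal 0 (NNReal.mk (ε ^ 2) (sq_nonneg _)) := by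
    have := (measurePreserving_coord (Sum.inl j)).map_eq
    have h' : (fun ω : Obs => ε * ω.1 j) = (fun x => ε * x) ∘ coord (Sum.inl j) := rfl
    rw [h', ← Measure.map_map (by fun_prop) (measurable_coord _), this, gaussianReal_map_const_mul]
    simp
  have h2 : noise.map (fun ω : Obs => (-c j) * ω.2 j) =
      gaussianReal 0 (NNReal.mk ((-c j) ^ 2) (sq_nonneg _)) := by
    have := (measurePreserving_coord (Sum.inr j)).map_eq
    have h' : (fun ω : Obs => (-c j) * ω.2 j) = (fun x => (-c j) * x) ∘ coord (Sum.inr j) := rfl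
    rw [h', ← Measure.map_map (by fun_prop) (measurable_coord _), this, gaussianReal_map_const_mul]
    simp
  have h3 := gaussianReal_add_gaussianReal_of_indepFun h h1 h2
  have h4 : residualNoise ε c j = (fun ω : Obs => ε * ω.1 j) + fun ω : Obs => (-c j) * ω.2 j := by
    ext ω; simp [residualNoise]; ring
  rw [h4, h3, gaussianReal_map_const_mul]
  congr 1
  · simp
  · ext; simp [Real.sq_sqrt (add_nonneg (sq_nonneg ε) (sq_nonneg (c j)))]

/-! ### Moments of a shifted Gaussian square -/

/-- The variance of the square of a standard Gaussian. -/
def gaussSqVar : ℝ := Var[fun x => x ^ 2; gaussianReal 0 1]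

lemma memLp_sq_gaussianReal : MemLp (fun x : ℝ => x ^ 2) 2 (gaussianReal 0 1) := by
  have h := memLp_id_gaussianReal' (μ := 0) (v := 1) 4 (by simp)
  have := h.norm_rpow_div 2
  have e : (4 : ℝ≥0∞) / 2 = 2 := by
    rw [eq_comm, ENNReal.eq_div_iff (by simp) (by simp)]; norm_num
  rw [e] at this
  simpa using this

lemma memLp_two_gaussianReal : MemLp (fun x : ℝ => x) 2 (gaussianReal 0 1) :=
  memLp_id_gaussianReal' 2 (by simp)

lemma integral_sq_gaussianReal : ∫ x, x ^ 2 ∂(gaussianReal 0 1) = 1 := by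
  have h := variance_fun_id_gaussianReal (μ := 0) (v := 1)
  rw [variance_of_integral_eq_zero (by fun_prop) integral_id_gaussianReal] at h
  simpa using h

/-- Nonnegativity of `Var[X - Y]` bounds the covariance, so the linear and quadratic parts of a
shifted square can be treated without computing theirs. -/
lemma variance_add_le_two_mul {Ω : Type*} {mΩ : MeasurableSpace Ω} {μ : Measure Ω}
    [IsFiniteMeasure μ] {X Y : Ω → ℝ} (hX : MemLp X 2 μ) (hY : MemLp Y 2 μ) :
    Var[fun ω => X ω + Y ω; μ] ≤ 2 * Var[X; μ] + 2 * Var[Y; μ] := by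
  have h := variance_nonneg (X - Y) μ
  rw [variance_sub hX hY] at h
  rw [variance_fun_add hX hY]
  linarith

lemma memLp_shifted_sq (m w : ℝ) :
    MemLp (fun x : ℝ => (m + w * x) ^ 2 - w ^ 2) 2 (gaussianReal 0 1) := by
  have h := ((memLp_two_gaussianReal.const_mul (2 * m * w)).add
    (memLp_sq_gaussianReal.const_mul (w ^ 2))).add (memLp_const (m ^ 2 - w ^ 2))
  refine h.ae_eq (.of_forall fun x => ?_)
  simp only [Pi.add_apply]; ring

lemma integral_shifted_sq (m w : ℝ) :
    ∫ x, ((m + w * x) ^ 2 - w ^ 2) ∂(gaussianReal 0 1) = m ^ 2 := by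
  have e : (fun x : ℝ => (m + w * x) ^ 2 - w ^ 2) =
      fun x => (2 * m * w * x + w ^ 2 * x ^ 2) + (m ^ 2 - w ^ 2) := by ext; ring
  have i1 := (memLp_two_gaussianReal.const_mul (2 * m * w)).integrable one_le_two
  have i2 := (memLp_sq_gaussianReal.const_mul (w ^ 2)).integrable one_le_two
  rw [e, integral_add (by exact i1.add i2) (integrable_const _), integral_add i1 i2, integral_const_mul,
    integral_const_mul, integral_id_gaussianReal, integral_sq_gaussianReal]
  simp

lemma variance_shifted_sq_le (m w : ℝ) :
    Var[fun x : ℝ => (m + w * x) ^ 2 - w ^ 2; gaussianReal 0 1] ≤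
      8 * m ^ 2 * w ^ 2 + 2 * gaussSqVar * (w ^ 2) ^ 2 := by
  have e : (fun x : ℝ => (m + w * x) ^ 2 - w ^ 2) =
      fun x => (2 * m * w * x + w ^ 2 * x ^ 2) + (m ^ 2 - w ^ 2) := by ext; ring
  rw [e, variance_add_const (by fun_prop)]
  refine (variance_add_le_two_mul (memLp_two_gaussianReal.const_mul _)
    (memLp_sq_gaussianReal.const_mul _)).trans ?_
  rw [variance_const_mul, variance_const_mul, variance_fun_id_gaussianReal, gaussSqVar]
  apply le_of_eq
  push_cast; ring

/-! ### Mean, variance and deviations of the quadratic statistic -/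

/-- The weighted quadratic statistic built from a sequence of residuals `m_j + W_j`. -/
def quadStat (ε : ℝ) (c w m : ℕ+ → ℝ) (S : Finset ℕ+) (ω : Obs) : ℝ :=
  ∑ j ∈ S, w j * ((m j + residualNoise ε c j ω) ^ 2 - (ε ^ 2 + c j ^ 2))

lemma measurePreserving_residualNoise (ε : ℝ) (c : ℕ+ → ℝ) (j : ℕ+) :
    MeasurePreserving (residualNoise ε c j) noise
      ((gaussianReal 0 1).map fun x => √(ε ^ 2 + c j ^ 2) * x) :=
  ⟨measurable_residualNoise ε c j, map_residualNoise ε c j⟩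

section quadStat

variable (ε : ℝ) (c w m : ℕ+ → ℝ)

lemma summand_eq_comp (j : ℕ+) :
    ((fun y => w j * ((m j + y) ^ 2 - (ε ^ 2 + c j ^ 2))) ∘ fun x => √(ε ^ 2 + c j ^ 2) * x) =
      fun x => w j * ((m j + √(ε ^ 2 + c j ^ 2) * x) ^ 2 - √(ε ^ 2 + c j ^ 2) ^ 2) := by
  rw [Real.sq_sqrt (by positivity)]; rfl

lemma memLp_summand (j : ℕ+) :
    MemLp (fun ω => w j * ((m j + residualNoise ε c j ω) ^ 2 - (ε ^ 2 + c j ^ 2))) 2 noise := by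
  have h : MemLp (fun y => w j * ((m j + y) ^ 2 - (ε ^ 2 + c j ^ 2))) 2
      ((gaussianReal 0 1).map fun x => √(ε ^ 2 + c j ^ 2) * x) := by
    rw [memLp_map_measure_iff (by fun_prop) (by fun_prop), summand_eq_comp]
    exact (memLp_shifted_sq _ _).const_mul _
  exact h.comp_measurePreserving (measurePreserving_residualNoise ε c j)

lemma integral_summand (j : ℕ+) :
    ∫ ω, w j * ((m j + residualNoise ε c j ω) ^ 2 - (ε ^ 2 + c j ^ 2)) ∂noise =
      w j * m j ^ 2 := by
  have h := integral_map (μ := noise) (φ := residualNoise ε c j)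
    (f := fun y => w j * ((m j + y) ^ 2 - (ε ^ 2 + c j ^ 2)))
    (measurable_residualNoise ε c j).aemeasurable (by fun_prop)
  rw [← h, map_residualNoise, integral_map (by fun_prop) (by fun_prop)]
  have := congrArg (fun f => ∫ x, f x ∂(gaussianReal 0 1)) (summand_eq_comp ε c w m j)
  refine this.trans ?_
  rw [integral_const_mul, integral_shifted_sq]

lemma variance_summand_le (j : ℕ+) :
    Var[fun ω => w j * ((m j + residualNoise ε c j ω) ^ 2 - (ε ^ 2 + c j ^ 2)); noise] ≤
      w j ^ 2 * (8 * m j ^ 2 * (ε ^ 2 + c j ^ 2) +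
        2 * gaussSqVar * (ε ^ 2 + c j ^ 2) ^ 2) := by
  rw [(measurePreserving_residualNoise ε c j).variance_fun_comp
    (f := fun y => w j * ((m j + y) ^ 2 - (ε ^ 2 + c j ^ 2))) (by fun_prop),
    variance_map (by fun_prop) (by fun_prop), summand_eq_comp, variance_const_mul]
  have := variance_shifted_sq_le (m j) √(ε ^ 2 + c j ^ 2)
  rw [Real.sq_sqrt (by positivity)] at this ⊢
  gcongr

lemma memLp_quadStat (S : Finset ℕ+) : MemLp (quadStat ε c w m S) 2 noise := by
  unfold quadStat
  exact memLp_finsetSum S fun j _ => memLp_summand ε c w m j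

lemma integral_quadStat (S : Finset ℕ+) :
    ∫ ω, quadStat ε c w m S ω ∂noise = ∑ j ∈ S, w j * m j ^ 2 := by
  unfold quadStat
  rw [integral_finsetSum S fun j _ => (memLp_summand ε c w m j).integrable one_le_two]
  exact Finset.sum_congr rfl fun j _ => integral_summand ε c w m j

lemma variance_quadStat_le (S : Finset ℕ+) :
    Var[quadStat ε c w m S; noise] ≤ ∑ j ∈ S, w j ^ 2 * (8 * m j ^ 2 * (ε ^ 2 + c j ^ 2) +
        2 * gaussSqVar * (ε ^ 2 + c j ^ 2) ^ 2) := by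
  have e : quadStat ε c w m S = ∑ j ∈ S, fun ω =>
      w j * ((m j + residualNoise ε c j ω) ^ 2 - (ε ^ 2 + c j ^ 2)) := by
    ext ω; simp [quadStat]
  rw [e, IndepFun.variance_sum (fun j _ => memLp_summand ε c w m j)]
  · exact Finset.sum_le_sum fun j _ => variance_summand_le ε c w m j
  · intro i _ j _ hij
    exact (indepFun_residualNoise ε c hij).comp
      (φ := fun y => w i * ((m i + y) ^ 2 - (ε ^ 2 + c i ^ 2)))
      (ψ := fun y => w j * ((m j + y) ^ 2 - (ε ^ 2 + c j ^ 2))) (by fun_prop) (by fun_prop)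

end quadStat

/-- The factor in the variance bound for the quadratic statistic. -/
def varConst : ℝ := 8 + 2 * gaussSqVar

lemma gaussSqVar_nonneg : 0 ≤ gaussSqVar := variance_nonneg _ _

lemma varConst_pos : 0 < varConst := by
  have := gaussSqVar_nonneg
  unfold varConst; linarith

/-- The variance of the quadratic statistic is controlled by its mean `M` and by the level `q` of
the noise. -/
lemma variance_quadStat_le_mean {ε q : ℝ} {c w m : ℕ+ → ℝ} {S : Finset ℕ+} (hw : ∀ j, 0 ≤ w j)
    (hq : 0 ≤ q) (hS : ∑ j ∈ S, (w j * (ε ^ 2 + c j ^ 2)) ^ 2 ≤ q ^ 2) :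
    Var[quadStat ε c w m S; noise] ≤ varConst * (q ^ 2 + q * ∑ j ∈ S, w j * m j ^ 2) := by
  have hV := gaussSqVar_nonneg
  have hM : 0 ≤ ∑ j ∈ S, w j * m j ^ 2 :=
    Finset.sum_nonneg fun j _ => mul_nonneg (hw j) (sq_nonneg _)
  -- The bound on the sum of squares also bounds each term; this turns the cross terms `w_j² m_j²
  -- (ε² + c_j²)` into `q` times the mean.
  have hj : ∀ j ∈ S, w j * (ε ^ 2 + c j ^ 2) ≤ q := fun j hj => by
    refine le_of_sq_le_sq ?_ hq
    exact (Finset.single_le_sum (f := fun j => (w j * (ε ^ 2 + c j ^ 2)) ^ 2)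
      (fun i _ => sq_nonneg _) hj).trans hS
  calc Var[quadStat ε c w m S; noise]
      ≤ ∑ j ∈ S, w j ^ 2 * (8 * m j ^ 2 * (ε ^ 2 + c j ^ 2) +
        2 * gaussSqVar * (ε ^ 2 + c j ^ 2) ^ 2) := variance_quadStat_le ε c w m S
    _ ≤ ∑ j ∈ S, (8 * q * (w j * m j ^ 2) +
        2 * gaussSqVar * (w j * (ε ^ 2 + c j ^ 2)) ^ 2) := by
        refine Finset.sum_le_sum fun j hjS => ?_
        have := mul_le_mul_of_nonneg_left (hj j hjS) (mul_nonneg (hw j) (sq_nonneg (m j)))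
        nlinarith
    _ = 8 * q * (∑ j ∈ S, w j * m j ^ 2) +
        2 * gaussSqVar * ∑ j ∈ S, (w j * (ε ^ 2 + c j ^ 2)) ^ 2 := by
        rw [Finset.sum_add_distrib, Finset.mul_sum, Finset.mul_sum]
    _ ≤ varConst * (q ^ 2 + q * ∑ j ∈ S, w j * m j ^ 2) := by
        unfold varConst
        have h1 := mul_le_mul_of_nonneg_left hS (mul_nonneg zero_le_two hV)
        have h2 := mul_nonneg hV (mul_nonneg hq hM)
        nlinarith [sq_nonneg q]

lemma noise_quadStat_gt_le {ε q H : ℝ} {c w m : ℕ+ → ℝ} {S : Finset ℕ+} (hw : ∀ j, 0 ≤ w j)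
    (hq : 0 < q) (hS : ∑ j ∈ S, (w j * (ε ^ 2 + c j ^ 2)) ^ 2 ≤ q ^ 2) (hm : ∀ j, m j = 0)
    (hH : 0 < H) :
    noise {ω | H * q < quadStat ε c w m S ω} ≤ ENNReal.ofReal (varConst / H ^ 2) := by
  have hM : ∑ j ∈ S, w j * m j ^ 2 = 0 := by simp [hm]
  have hv := variance_quadStat_le_mean (m := m) hw hq.le hS
  have hc := meas_ge_le_variance_div_sq (memLp_quadStat ε c w m S) (mul_pos hH hq)
  rw [integral_quadStat, hM] at hc
  rw [hM] at hv
  refine (measure_mono fun ω hω => ?_).trans (hc.trans (ENNReal.ofReal_le_ofReal ?_))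
  · simp only [Set.mem_ofPred_eq, sub_zero] at hω ⊢
    exact hω.le.trans (le_abs_self _)
  · rw [div_le_div_iff₀ (by positivity) (by positivity)]
    nlinarith [mul_le_mul_of_nonneg_right hv (sq_nonneg H)]

/-- The threshold is at most half the mean `M`, so acceptance is a deviation of at least `M / 2`. As
`q ≤ M / K`, the variance is at most `2 * varConst * M² / K`, and Chebyshev's inequality supplies
the factor `8`. -/
lemma noise_quadStat_le_le {ε q H K : ℝ} {c w m : ℕ+ → ℝ} {S : Finset ℕ+} (hw : ∀ j, 0 ≤ w j)
    (hq : 0 < q) (hS : ∑ j ∈ S, (w j * (ε ^ 2 + c j ^ 2)) ^ 2 ≤ q ^ 2)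
    (hK : 1 ≤ K) (hHK : 2 * H ≤ K) (hM : K * q ≤ ∑ j ∈ S, w j * m j ^ 2) :
    noise {ω | quadStat ε c w m S ω ≤ H * q} ≤ ENNReal.ofReal (8 * varConst / K) := by
  have hv := variance_quadStat_le_mean (m := m) hw hq.le hS
  have hA := varConst_pos
  set M := ∑ j ∈ S, w j * m j ^ 2 with hMdef
  have hMq : q ≤ M := (le_mul_of_one_le_left hq.le hK).trans hM
  have hMpos : 0 < M := hq.trans_le hMq
  have hc := meas_ge_le_variance_div_sq (memLp_quadStat ε c w m S) (half_pos hMpos)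
  rw [integral_quadStat, ← hMdef] at hc
  refine (measure_mono fun ω hω => ?_).trans (hc.trans (ENNReal.ofReal_le_ofReal ?_))
  · simp only [Set.mem_ofPred_eq] at hω ⊢
    have : H * q ≤ M / 2 := by nlinarith
    rw [abs_sub_comm]
    exact le_trans (by linarith) (le_abs_self _)
  · rw [div_le_div_iff₀ (by positivity) (by positivity)]
    have h1 : q ^ 2 + q * M ≤ 2 * (q * M) := by nlinarith
    have h2 : K * (q * M) ≤ M ^ 2 := by nlinarith
    calc Var[quadStat ε c w m S; noise] * K ≤ varConst * (2 * (q * M)) * K := by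
          gcongr; exact hv.trans (by gcongr)
      _ = 2 * varConst * (K * (q * M)) := by ring
      _ ≤ 2 * varConst * M ^ 2 := by gcongr
      _ = 8 * varConst * (M / 2) ^ 2 := by ring

/-! ### The residual test -/

lemma minimaxRadius_sq_le_of_test {a : ℕ+ → ℝ} {B : Set (ℕ+ → ℝ)} {α β ε σ r : ℝ} (hr : 0 < r)
    (Ψ : Test) (hα : HasLevel a B ε σ α Ψ)
    (hβ : ∀ θ₀ ∈ ellipsoid a, ∀ θ : L2, θ - θ₀ ∈ separated a r → ∀ b ∈ B,
      law ε σ θ b {x | Ψ.toFun θ₀ x = 0} ≤ ENNReal.ofReal β) :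
    minimaxRadius a B α β ε σ ^ 2 ≤ ENNReal.ofReal (r ^ 2) := by
  rw [ENNReal.ofReal_pow hr.le]
  gcongr
  refine (iInf₂_le Ψ hα).trans ((iInf₂_le r hr).trans (iInf_le _ ?_))
  simp only [secondKindError, iSup_le_iff]
  exact fun θ₀ θ b h₀ h₁ hb => hβ θ₀ h₀ θ h₁ b hb

/-- The statistic of the test: a weighted sum of squares of the residuals `Y_j - θ₀_j X_j`, whose
variances `ε² + σ² θ₀_j²` under the null hypothesis are known. -/
def residualStat (ε σ : ℝ) (w : ℕ+ → ℝ) (S : Finset ℕ+) (θ₀ : L2) (x : Obs) : ℝ :=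
  ∑ j ∈ S, w j * ((x.1 j - θ₀ j * x.2 j) ^ 2 - (ε ^ 2 + (σ * θ₀ j) ^ 2))

lemma measurable_residualStat (ε σ : ℝ) (w : ℕ+ → ℝ) (S : Finset ℕ+) (θ₀ : L2) :
    Measurable (residualStat ε σ w S θ₀) := by
  unfold residualStat; fun_prop

lemma residualStat_observe (ε σ : ℝ) (w : ℕ+ → ℝ) (S : Finset ℕ+) (θ₀ θ : L2) (b : ℕ+ → ℝ)
    (ω : Obs) : residualStat ε σ w S θ₀ (observe ε σ θ b ω) =
      quadStat ε (fun j => σ * θ₀ j) w (fun j => b j * (θ - θ₀) j) S ω := by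
  refine Finset.sum_congr rfl fun j _ => ?_
  have : (θ - θ₀) j = θ j - θ₀ j := rfl
  simp only [observe, residualNoise, this]
  ring

/-- The test that rejects when the statistic exceeds the threshold `h`. -/
def residualTest (ε σ : ℝ) (w : ℕ+ → ℝ) (S : Finset ℕ+) (h : ℝ) : Test where
  toFun θ₀ x := if h < residualStat ε σ w S θ₀ x then 1 else 0
  measurable θ₀ := Measurable.ite
    (measurableSet_lt measurable_const (measurable_residualStat ε σ w S θ₀))
    measurable_const measurable_const

lemma law_residualTest_eq_one (ε σ : ℝ) (w : ℕ+ → ℝ) (S : Finset ℕ+) (h : ℝ) (θ₀ θ : L2)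
    (b : ℕ+ → ℝ) : law ε σ θ b {x | (residualTest ε σ w S h).toFun θ₀ x = 1} =
      noise {ω | h < quadStat ε (fun j => σ * θ₀ j) w (fun j => b j * (θ - θ₀) j) S ω} := by
  have hs : MeasurableSet {x | (residualTest ε σ w S h).toFun θ₀ x = 1} :=
    (residualTest ε σ w S h).measurable θ₀ (measurableSet_singleton 1)
  refine (Measure.map_apply (measurable_observe ε σ θ b) hs).trans (congrArg noise ?_)
  ext ω
  simp [residualTest, residualStat_observe]

lemma law_residualTest_eq_zero (ε σ : ℝ) (w : ℕ+ → ℝ) (S : Finset ℕ+) (h : ℝ) (θ₀ θ : L2)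
    (b : ℕ+ → ℝ) : law ε σ θ b {x | (residualTest ε σ w S h).toFun θ₀ x = 0} =
      noise {ω | quadStat ε (fun j => σ * θ₀ j) w (fun j => b j * (θ - θ₀) j) S ω ≤ h} := by
  have hs : MeasurableSet {x | (residualTest ε σ w S h).toFun θ₀ x = 0} :=
    (residualTest ε σ w S h).measurable θ₀ (measurableSet_singleton 0)
  refine (Measure.map_apply (measurable_observe ε σ θ b) hs).trans (congrArg noise ?_)
  ext ω
  simp [residualTest, residualStat_observe]

/-! ### Ellipsoid estimates and the general bound on the radius -/

lemma sum_le_one_of_mem_ellipsoid {a : ℕ+ → ℝ} {θ : L2} (hθ : θ ∈ ellipsoid a)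
    (S : Finset ℕ+) : ∑ j ∈ S, a j ^ 2 * θ j ^ 2 ≤ 1 :=
  (hθ.1.sum_le_tsum S fun j _ => by positivity).trans hθ.2

lemma hasSum_sq (θ : L2) : HasSum (fun j => θ j ^ 2) (‖θ‖ ^ 2) := by
  have h := lp.hasSum_norm (p := 2) (by norm_num) θ
  simpa using h

/-- The coordinates up to `D` carry the squared norm up to `a_D⁻²`. -/
lemma norm_sq_le_sum_add {a : ℕ+ → ℝ} (ha : IsSmoothness a) {θ : L2} (hθ : θ ∈ ellipsoid a)
    (D : ℕ+) : ‖θ‖ ^ 2 ≤ ∑ j ∈ Finset.Icc 1 D, θ j ^ 2 + (a D ^ 2)⁻¹ := by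
  have h1 : HasSum (fun j => if j ∈ Finset.Icc 1 D then θ j ^ 2 else 0)
      (∑ j ∈ Finset.Icc 1 D, θ j ^ 2) := by
    have := hasSum_sum_of_ne_finset_zero (L := .unconditional ℕ+)
      (s := Finset.Icc 1 D)
      (f := fun j => if j ∈ Finset.Icc 1 D then θ j ^ 2 else 0) (fun j hj => if_neg hj)
    rwa [Finset.sum_congr rfl fun j hj => if_pos hj] at this
  have h2 := hθ.1.hasSum.mul_left (a D ^ 2)⁻¹
  have hD := ha.pos D
  have h3 := hasSum_le (fun j => ?_) (hasSum_sq θ) (h1.add h2)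
  · refine h3.trans ?_
    gcongr
    exact mul_le_of_le_one_right (by positivity) hθ.2
  · by_cases hj : j ∈ Finset.Icc 1 D
    · rw [if_pos hj]
      exact le_add_of_nonneg_right (by positivity)
    -- Beyond `D`, monotonicity gives `a_j² / a_D² ≥ 1`, so the ellipsoid sum controls the tail.
    · rw [if_neg hj, zero_add, ← mul_assoc]
      have hDj : D ≤ j := by
        rw [Finset.mem_Icc, not_and, not_le] at hj
        exact (hj one_le).le
      have : a D ^ 2 ≤ a j ^ 2 := pow_le_pow_left₀ hD.le (ha.mono hDj) 2
      refine le_mul_of_one_le_left (sq_nonneg _) ?_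
      rwa [inv_mul_eq_div, one_le_div (by positivity)]

/-- The noise in `X` is weighted by `d_j⁻² θ_j² ≤ Q a_j² θ_j²`. Since `∑ (a_j² θ_j²)² ≤ ∑ a_j² θ_j²
≤ 1`, its total is bounded independently of the number of coordinates. -/
lemma sum_noise_level_sq_le {a d : ℕ+ → ℝ} (hd : ∀ j, 0 < d j) {θ : L2}
    (hθ : θ ∈ ellipsoid a) {ε σ P Q : ℝ} {S : Finset ℕ+} (hP : 0 ≤ P) (hQ : 0 ≤ Q)
    (hSP : ∑ j ∈ S, (d j ^ 4)⁻¹ ≤ P ^ 2) (hSQ : ∀ j ∈ S, 1 ≤ Q * (a j * d j) ^ 2) :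
    ∑ j ∈ S, ((d j ^ 2)⁻¹ * (ε ^ 2 + (σ * θ j) ^ 2)) ^ 2 ≤
      (2 * (ε ^ 2 * P + σ ^ 2 * Q)) ^ 2 := by
  have hterm : ∀ j ∈ S, ((d j ^ 2)⁻¹ * (ε ^ 2 + (σ * θ j) ^ 2)) ^ 2 ≤
      2 * ε ^ 4 * (d j ^ 4)⁻¹ + 2 * (σ ^ 2 * Q) ^ 2 * (a j ^ 2 * θ j ^ 2) := fun j hj => by
    have hdj := hd j
    have hx : a j ^ 2 * θ j ^ 2 ≤ 1 := by
      simpa using sum_le_one_of_mem_ellipsoid hθ {j}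
    have hx0 : 0 ≤ a j ^ 2 * θ j ^ 2 := by positivity
    have h1 : (d j ^ 2)⁻¹ * (σ * θ j) ^ 2 ≤ σ ^ 2 * Q * (a j ^ 2 * θ j ^ 2) := by
      rw [inv_mul_le_iff₀ (by positivity)]
      calc (σ * θ j) ^ 2 ≤ (σ * θ j) ^ 2 * (Q * (a j * d j) ^ 2) :=
            le_mul_of_one_le_right (sq_nonneg _) (hSQ j hj)
        _ = _ := by ring
    have h0 : 0 ≤ (d j ^ 2)⁻¹ * (σ * θ j) ^ 2 := by positivity
    calc ((d j ^ 2)⁻¹ * (ε ^ 2 + (σ * θ j) ^ 2)) ^ 2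
        = ((d j ^ 2)⁻¹ * ε ^ 2 + (d j ^ 2)⁻¹ * (σ * θ j) ^ 2) ^ 2 := by ring
      _ ≤ 2 * ((d j ^ 2)⁻¹ * ε ^ 2) ^ 2 + 2 * ((d j ^ 2)⁻¹ * (σ * θ j) ^ 2) ^ 2 := by
          nlinarith [sq_nonneg ((d j ^ 2)⁻¹ * ε ^ 2 - (d j ^ 2)⁻¹ * (σ * θ j) ^ 2)]
      _ ≤ 2 * ((d j ^ 2)⁻¹ * ε ^ 2) ^ 2 + 2 * (σ ^ 2 * Q * (a j ^ 2 * θ j ^ 2)) ^ 2 := by gcongr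
      _ = 2 * ε ^ 4 * (d j ^ 4)⁻¹ +
          2 * (σ ^ 2 * Q) ^ 2 * ((a j ^ 2 * θ j ^ 2) * (a j ^ 2 * θ j ^ 2)) := by
          field_simp
      _ ≤ _ := add_le_add le_rfl
          (mul_le_mul_of_nonneg_left (mul_le_of_le_one_left hx0 hx) (by positivity))
  refine (Finset.sum_le_sum hterm).trans ?_
  rw [Finset.sum_add_distrib, ← Finset.mul_sum, ← Finset.mul_sum]
  have h1 : 2 * ε ^ 4 * ∑ j ∈ S, (d j ^ 4)⁻¹ ≤ 2 * ε ^ 4 * P ^ 2 := by gcongr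
  have h2 : 2 * (σ ^ 2 * Q) ^ 2 * ∑ j ∈ S, a j ^ 2 * θ j ^ 2 ≤ 2 * (σ ^ 2 * Q) ^ 2 :=
    mul_le_of_le_one_right (by positivity) (sum_le_one_of_mem_ellipsoid hθ S)
  have h3 : 0 ≤ ε ^ 2 * P * (σ ^ 2 * Q) := by positivity
  nlinarith [sq_nonneg (ε ^ 2 * P), sq_nonneg (σ ^ 2 * Q)]

/-- The radius reached by the residual test with the coordinates up to `D`: a squared bias, the
noise in `Y`, and the noise in `X`. -/
lemma exists_minimaxRadius_sq_le {α β κ : ℝ} (hα : 0 < α) (hβ : 0 < β) (hκ : 0 < κ) :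
    ∃ K : ℝ, 0 < K ∧ ∀ (a d : ℕ+ → ℝ) (B : Set (ℕ+ → ℝ)) (ε σ P Q : ℝ) (D : ℕ+),
      IsSmoothness a → (∀ j, 0 < d j) → (∀ b ∈ B, ∀ j, κ ≤ b j / d j) → 0 < ε → 0 < P → 0 ≤ Q →
      ∑ j ∈ Finset.Icc 1 D, (d j ^ 4)⁻¹ ≤ P ^ 2 → (∀ j ≤ D, 1 ≤ Q * (a j * d j) ^ 2) →
      minimaxRadius a B α β ε σ ^ 2 ≤
        ENNReal.ofReal (K * ((a D ^ 2)⁻¹ + ε ^ 2 * P + σ ^ 2 * Q)) := by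
  have hA := varConst_pos
  -- `H` makes the Chebyshev bound under the null equal to `α`; `R` below makes the one under the
  -- alternative at most `β`.
  set H := √(varConst / α) with hHdef
  have hH : 0 < H := Real.sqrt_pos.2 (by positivity)
  have hH2 : H ^ 2 = varConst / α := Real.sq_sqrt (by positivity)
  set R := max 1 (max (2 * H) (8 * varConst / β)) with hRdef
  have hR1 : 1 ≤ R := le_max_left _ _
  have hRH : 2 * H ≤ R := (le_max_left _ _).trans (le_max_right _ _)
  have hRβ : 8 * varConst / R ≤ β := by
    rw [div_le_iff₀ (by positivity), ← div_le_iff₀' hβ]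
    exact (le_max_right _ _).trans (le_max_right _ _)
  refine ⟨max 1 (2 * R / κ ^ 2), lt_max_of_lt_left one_pos, ?_⟩
  intro a d B ε σ P Q D ha hd hB hε hP hQ hSP hSQ
  set q := 2 * (ε ^ 2 * P + σ ^ 2 * Q) with hqdef
  have hq : 0 < q := by positivity
  have haD := ha.pos D
  set S := Finset.Icc 1 D
  set w : ℕ+ → ℝ := fun j => (d j ^ 2)⁻¹ with hwdef
  have hw : ∀ j, 0 ≤ w j := fun j => by positivity
  -- After the tail takes at most `a_D⁻²`, the first `D` coordinates keep `R q / κ²`; as `b_j / d_j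
  -- ≥ κ`, the mean of the statistic is at least `R q`.
  set r := √((a D ^ 2)⁻¹ + R * q / κ ^ 2) with hrdef
  have hr2 : r ^ 2 = (a D ^ 2)⁻¹ + R * q / κ ^ 2 := Real.sq_sqrt (by positivity)
  have hr : 0 < r := Real.sqrt_pos.2 (by positivity)
  have hnoise : ∀ θ₀ ∈ ellipsoid a,
      ∑ j ∈ S, (w j * (ε ^ 2 + (σ * θ₀ j) ^ 2)) ^ 2 ≤ q ^ 2 := fun θ₀ h₀ =>
    sum_noise_level_sq_le hd h₀ hP.le hQ hSP fun j hj => hSQ j (Finset.mem_Icc.1 hj).2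
  have hmain := minimaxRadius_sq_le_of_test (B := B) (a := a) (α := α) (β := β) (ε := ε) (σ := σ) hr
    (residualTest ε σ w S (H * q)) ?_ ?_
  · refine hmain.trans (ENNReal.ofReal_le_ofReal ?_)
    rw [hr2]
    have h1 : (a D ^ 2)⁻¹ ≤ max 1 (2 * R / κ ^ 2) * (a D ^ 2)⁻¹ :=
      le_mul_of_one_le_left (by positivity) (le_max_left _ _)
    have h2 : 2 * R / κ ^ 2 * (ε ^ 2 * P + σ ^ 2 * Q) ≤
        max 1 (2 * R / κ ^ 2) * (ε ^ 2 * P + σ ^ 2 * Q) := by gcongr; exact le_max_right _ _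
    have h3 : R * q / κ ^ 2 = 2 * R / κ ^ 2 * (ε ^ 2 * P + σ ^ 2 * Q) := by rw [hqdef]; ring
    rw [h3]
    linarith
  · intro θ₀ h₀ b hb
    rw [law_residualTest_eq_one]
    refine (noise_quadStat_gt_le hw hq (hnoise θ₀ h₀) (fun j => ?_) hH).trans ?_
    · rw [sub_self]; simp
    · rw [hH2, div_div_cancel₀ hA.ne']
  · intro θ₀ h₀ θ hθ b hb
    rw [law_residualTest_eq_zero]
    refine (noise_quadStat_le_le hw hq (hnoise θ₀ h₀) hR1 hRH ?_).trans
      (ENNReal.ofReal_le_ofReal hRβ)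
    have hnorm := norm_sq_le_sum_add ha hθ.1 D
    have hrn : r ^ 2 ≤ ‖θ - θ₀‖ ^ 2 := pow_le_pow_left₀ hr.le hθ.2 2
    have hsum : κ ^ 2 * ∑ j ∈ S, (θ - θ₀) j ^ 2 ≤
        ∑ j ∈ S, w j * (b j * (θ - θ₀) j) ^ 2 := by
      rw [Finset.mul_sum]
      refine Finset.sum_le_sum fun j _ => ?_
      have e : w j * (b j * (θ - θ₀) j) ^ 2 = (b j / d j) ^ 2 * (θ - θ₀) j ^ 2 := by
        have := (hd j).ne'
        simp only [hwdef]; field_simp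
      rw [e]
      gcongr
      exact hB b hb j
    refine le_trans ?_ hsum
    have h4 : R * q / κ ^ 2 ≤ ∑ j ∈ S, (θ - θ₀) j ^ 2 := by linarith
    rwa [div_le_iff₀' (by positivity)] at h4

/-- A rate is an upper bound once, for all small noise levels, some truncation `D` balances the
squared bias and the two noise terms at that rate. -/
lemma hasUpperRate_of_exists_truncation {α β : ℝ} (hα : 0 < α) (hβ : 0 < β) {a a' d : ℕ+ → ℝ}
    {B : Set (ℕ+ → ℝ)} (ha : IsSmoothness a) (hd : ∀ j, 0 < d j) (ha' : ∀ j, 0 < a' j)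
    (hBd : EquivOn B d) (haa' : SeqEquiv a a') {rate : ℝ → ℝ → ℝ} {ε₀ σ₀ C : ℝ}
    (hε₀ : ε₀ ∈ Ioo (0 : ℝ) 1) (hσ₀ : σ₀ ∈ Ioo (0 : ℝ) 1) (hC : 0 < C)
    (h : ∀ ε σ : ℝ, 0 < ε → ε ≤ ε₀ → 0 < σ → σ ≤ σ₀ → ∃ (D : ℕ+) (P Q : ℝ), 0 < P ∧ 0 ≤ Q ∧
      ∑ j ∈ Finset.Icc 1 D, (d j ^ 4)⁻¹ ≤ P ^ 2 ∧ (∀ j ≤ D, 1 ≤ Q * (a' j * d j) ^ 2) ∧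
      (a' D ^ 2)⁻¹ + ε ^ 2 * P + σ ^ 2 * Q ≤ C * rate ε σ) :
    HasUpperRate a B α β rate := by
  obtain ⟨κ, _, hκ, -, hB⟩ := hBd
  obtain ⟨ν, _, hν, -, hν'⟩ := haa'
  have haν : ∀ j, ν * a' j ≤ a j := fun j => (le_div_iff₀ (ha' j)).1 (hν' j).1
  obtain ⟨K, hK, hmain⟩ := exists_minimaxRadius_sq_le hα hβ hκ
  -- Passing from `a` to `a'` costs `ν⁻²` in the bias and in `Q`; the maximum with `1` lets the same
  -- factor cover `ε² P`.
  set N := max 1 (ν ^ 2)⁻¹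
  have hN : 0 < N := lt_max_of_lt_left one_pos
  refine ⟨ε₀, hε₀, σ₀, hσ₀, K * N * C, by positivity, fun ε σ hε hε' hσ hσ' => ?_⟩
  obtain ⟨D, P, Q, hP, hQ, hSP, hSQ, hbound⟩ := h ε σ hε hε' hσ hσ'
  refine (hmain a d B ε σ P (N * Q) D ha hd (fun b hb j => (hB b hb j).1) hε hP (by positivity) hSP
    fun j hj => ?_).trans (ENNReal.ofReal_le_ofReal ?_)
  · have hdj := hd j
    have h1 : (ν ^ 2)⁻¹ ≤ N := le_max_right _ _
    have := ha' j
    calc 1 ≤ Q * (a' j * d j) ^ 2 := hSQ j hj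
      _ = (ν ^ 2)⁻¹ * Q * (ν * a' j * d j) ^ 2 := by field_simp
      _ ≤ N * Q * (a j * d j) ^ 2 := by gcongr; exact haν j
  · rw [mul_assoc K, mul_assoc K, mul_assoc N]
    gcongr
    refine le_trans ?_ (mul_le_mul_of_nonneg_left hbound hN.le)
    have := ha' D
    have h1 : (a D ^ 2)⁻¹ ≤ N * (a' D ^ 2)⁻¹ := by
      calc (a D ^ 2)⁻¹ ≤ ((ν * a' D) ^ 2)⁻¹ := by gcongr; exact haν D
        _ = (ν ^ 2)⁻¹ * (a' D ^ 2)⁻¹ := by rw [mul_pow, mul_inv]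
        _ ≤ _ := by gcongr; exact le_max_right _ _
    have h2 : ε ^ 2 * P ≤ N * (ε ^ 2 * P) :=
      le_mul_of_one_le_left (by positivity) (le_max_left _ _)
    linarith

/-! ### Logarithmic noise levels and elementary estimates -/

lemma log_one_div_exp_neg (y : ℝ) : Real.log (1 / Real.exp (-y)) = y := by
  rw [one_div, ← Real.exp_neg, neg_neg, Real.log_exp]

/-- The criterion `hasUpperRate_of_exists_truncation` in terms of `y = ln (1/ε)` and
`z = ln (1/σ)`. -/
lemma hasUpperRate_of_exists_truncation_exp {α β : ℝ} (hα : 0 < α) (hβ : 0 < β)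
    {a a' d : ℕ+ → ℝ} {B : Set (ℕ+ → ℝ)} (ha : IsSmoothness a) (hd : ∀ j, 0 < d j)
    (ha' : ∀ j, 0 < a' j) (hBd : EquivOn B d) (haa' : SeqEquiv a a') {rate : ℝ → ℝ → ℝ}
    {L C : ℝ} (hL : 0 < L) (hC : 0 < C)
    (h : ∀ y z : ℝ, L ≤ y → L ≤ z → ∃ (D : ℕ+) (P Q : ℝ), 0 < P ∧ 0 ≤ Q ∧
      ∑ j ∈ Finset.Icc 1 D, (d j ^ 4)⁻¹ ≤ P ^ 2 ∧ (∀ j ≤ D, 1 ≤ Q * (a' j * d j) ^ 2) ∧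
      (a' D ^ 2)⁻¹ + Real.exp (-y) ^ 2 * P + Real.exp (-z) ^ 2 * Q ≤
        C * rate (Real.exp (-y)) (Real.exp (-z))) :
    HasUpperRate a B α β rate := by
  have hL' : Real.exp (-L) ∈ Ioo (0 : ℝ) 1 := ⟨Real.exp_pos _, by simpa using hL⟩
  refine hasUpperRate_of_exists_truncation hα hβ ha hd ha' hBd haa' hL' hL' hC
    fun ε σ hε hε' hσ hσ' => ?_
  have h1 : L ≤ -Real.log ε := by
    have := Real.log_le_log hε hε'
    rw [Real.log_exp] at this; linarith
  have h2 : L ≤ -Real.log σ := by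
    have := Real.log_le_log hσ hσ'
    rw [Real.log_exp] at this; linarith
  have := h _ _ h1 h2
  simpa only [neg_neg, Real.exp_log hε, Real.exp_log hσ] using this

/-- Rounding must cost only a constant in the bias: the bound `x / 2` serves polynomial `a`, and `x
- 1` serves exponential `a`. -/
lemma exists_pnat_floor {x : ℝ} (hx : 1 ≤ x) :
    ∃ D : ℕ+, x / 2 ≤ (D : ℝ) ∧ (D : ℝ) ≤ x ∧ x - 1 ≤ (D : ℝ) := by
  have hpos : 0 < ⌊x⌋₊ := Nat.floor_pos.2 hx
  refine ⟨⟨⌊x⌋₊, hpos⟩, ?_, Nat.floor_le (by linarith), ?_⟩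
  · have h1 := Nat.lt_floor_add_one x
    have h2 : (1 : ℝ) ≤ ⌊x⌋₊ := by exact_mod_cast hpos
    simp only [PNat.mk_coe]; linarith
  · have h1 := Nat.lt_floor_add_one x
    simp only [PNat.mk_coe]; linarith

lemma one_le_pnat_cast (j : ℕ+) : (1 : ℝ) ≤ (j : ℝ) := by exact_mod_cast j.2

lemma pnat_cast_pos (j : ℕ+) : (0 : ℝ) < (j : ℝ) := by exact_mod_cast j.2

lemma pnat_cast_le {i j : ℕ+} (h : i ≤ j) : (i : ℝ) ≤ (j : ℝ) := by exact_mod_cast h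

lemma sum_rpow_le (t : ℝ) (ht : 0 < t) (D : ℕ+) :
    ∑ j ∈ Finset.Icc 1 D, (((j : ℝ) ^ (-t)) ^ 4)⁻¹ ≤ ((D : ℝ) ^ (2 * t + 1 / 2)) ^ 2 := by
  have hD := pnat_cast_pos D
  calc ∑ j ∈ Finset.Icc 1 D, (((j : ℝ) ^ (-t)) ^ 4)⁻¹
      ≤ ∑ j ∈ Finset.Icc 1 D, (D : ℝ) ^ (4 * t) := by
        refine Finset.sum_le_sum fun j hj => ?_
        have hj0 := pnat_cast_pos j
        rw [← Real.rpow_mul_natCast hj0.le, ← Real.rpow_neg hj0.le]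
        have e : -(-t * (4 : ℕ)) = 4 * t := by push_cast; ring
        rw [e]
        exact Real.rpow_le_rpow hj0.le (pnat_cast_le (Finset.mem_Icc.1 hj).2) (by positivity)
    _ = (D : ℝ) * (D : ℝ) ^ (4 * t) := by simp
    _ = ((D : ℝ) ^ (2 * t + 1 / 2)) ^ 2 := by
        rw [← Real.rpow_mul_natCast hD.le, ← Real.rpow_one_add' hD.le (by positivity)]
        congr 1; push_cast; ring

/-- A growing geometric sum is comparable to its last term. After multiplication by `1 - e^(-4t)`,
the induction step is an identity. -/
lemma sum_exp_le (t : ℝ) (ht : 0 < t) (D : ℕ+) :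
    ∑ j ∈ Finset.Icc 1 D, (Real.exp (-(j * t)) ^ 4)⁻¹ ≤
      ((√(1 - Real.exp (-(4 * t))))⁻¹ * Real.exp (2 * t * D)) ^ 2 := by
  have hg : 0 < 1 - Real.exp (-(4 * t)) := by
    have : Real.exp (-(4 * t)) < 1 := by simpa using ht
    linarith
  rw [mul_pow, inv_pow, Real.sq_sqrt hg.le, inv_mul_eq_div, le_div_iff₀ hg]
  have e : ∀ j : ℕ+, (Real.exp (-(j * t)) ^ 4)⁻¹ = Real.exp (4 * t * j) := fun j => by
    rw [← Real.exp_nat_mul, ← Real.exp_neg]; congr 1; push_cast; ring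
  have e2 : ∀ D : ℕ+, Real.exp (2 * t * D) ^ 2 = Real.exp (4 * t * D) := fun D => by
    rw [← Real.exp_nat_mul]; congr 1; push_cast; ring
  simp only [e, e2]
  induction D using PNat.recOn with
  | one =>
    simp only [Finset.Icc_self, Finset.sum_singleton]
    exact mul_le_of_le_one_right (Real.exp_pos _).le (by linarith [Real.exp_pos (-(4 * t))])
  | succ D ih =>
    have hI : Finset.Icc 1 (D + 1) = insert (D + 1) (Finset.Icc 1 D) := by
      ext j
      simp only [Finset.mem_insert, Finset.mem_Icc, ← PNat.coe_le_coe, ← PNat.coe_inj,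
        PNat.add_coe, PNat.one_coe]
      have := D.2; have := j.2
      omega
    have hn : D + 1 ∉ Finset.Icc 1 D := by
      simp only [Finset.mem_Icc, ← PNat.coe_le_coe, PNat.add_coe, PNat.one_coe]
      omega
    rw [hI, Finset.sum_insert hn, add_mul]
    refine (add_le_add le_rfl ih).trans (le_of_eq ?_)
    have : Real.exp (4 * t * D) = Real.exp (4 * t * ((D + 1 : ℕ+) : ℕ)) * Real.exp (-(4 * t)) := by
      rw [← Real.exp_add]; congr 1; push_cast; ring
    rw [this]; ring

/-- This is `x / p ≤ e^(x / p)` raised to the power `p`. -/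
lemma rpow_le_const_mul_exp {p x : ℝ} (hp : 0 < p) (hx : 0 ≤ x) :
    x ^ p ≤ p ^ p * Real.exp x := by
  have h : x / p ≤ Real.exp (x / p) := by linarith [Real.add_one_le_exp (x / p)]
  have h2 := Real.rpow_le_rpow (by positivity) h hp.le
  rwa [Real.div_rpow hx hp.le, ← Real.exp_mul, div_mul_cancel₀ _ hp.ne',
    div_le_iff₀' (by positivity)] at h2

/-- With `σ = e^(-z)`, a pure power of `σ` is absorbed by the stated rates, because the factor `z ^
γ` is at least `1`. -/
lemma exp_neg_mul_le_rpow {z γ m m' : ℝ} (hz : 1 ≤ z) (hγ : 0 ≤ γ) (hm : 0 ≤ m) (hm' : m ≤ m') :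
    Real.exp (-z * m') ≤ (Real.exp (-z) * z ^ γ) ^ m := by
  calc Real.exp (-z * m') ≤ Real.exp (-z * m) := Real.exp_le_exp.2 (by nlinarith)
    _ = Real.exp (-z) ^ m := Real.exp_mul _ _
    _ ≤ _ := Real.rpow_le_rpow (Real.exp_pos _).le
        (le_mul_of_one_le_right (Real.exp_pos _).le (Real.one_le_rpow hz hγ)) hm

lemma one_sub_max_div_eq_min {s t : ℝ} (ht : 0 < t) : 1 - max (t - s) 0 / t = min (s / t) 1 := by
  rcases le_total s t with h | h
  · rw [max_eq_left (by linarith), min_eq_left ((div_le_one ht).2 h)]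
    field_simp; ring
  · rw [max_eq_right (by linarith), min_eq_right ((one_le_div ht).2 h)]
    simp

/-- The noise in `X` contributes `σ^(2 min(s/t, 1))` when it is amplified by at most
`e^(2 (t - s)₊ z / t)`, where `σ = e^(-z)`. -/
lemma exp_neg_sq_mul_exp_le {s t z x γ : ℝ} (hs : 0 < s) (ht : 0 < t) (hz : 1 ≤ z) (hγ : 0 ≤ γ)
    (hx : x ≤ z / t) : Real.exp (-z) ^ 2 * Real.exp (2 * max (t - s) 0 * x) ≤
      (Real.exp (-z) * z ^ γ) ^ (2 * min (s / t) 1) := by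
  have hm : 0 ≤ min (s / t) 1 := le_min (by positivity) zero_le_one
  refine le_trans ?_ (exp_neg_mul_le_rpow hz hγ (by positivity) le_rfl)
  rw [← Real.exp_nat_mul, ← Real.exp_add, ← one_sub_max_div_eq_min ht]
  refine Real.exp_le_exp.2 ?_
  have h1 : max (t - s) 0 * x ≤ max (t - s) 0 * (z / t) :=
    mul_le_mul_of_nonneg_left hx (le_max_right _ _)
  have h2 : max (t - s) 0 / t * z = max (t - s) 0 * (z / t) := by ring
  push_cast
  nlinarith

/-! ### Choice of the truncation in the four cases -/

section rates

variable {α β s t : ℝ} {a : ℕ+ → ℝ} {B : Set (ℕ+ → ℝ)}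

lemma hasUpperRate_rpow_rpow (hα : 0 < α) (hβ : 0 < β) (hs : 0 < s) (ht : 0 < t)
    (ha : IsSmoothness a) (hB : EquivOn B fun j => (j : ℝ) ^ (-t))
    (ha' : SeqEquiv a fun j => (j : ℝ) ^ s) :
    HasUpperRate a B α β fun ε σ =>
      max (ε ^ (4 * s / (2 * s + 2 * t + 1 / 2)))
        ((σ * Real.log (1 / σ) ^ (3 / 4 : ℝ)) ^ (2 * min (s / t) 1)) := by
  refine hasUpperRate_of_exists_truncation_exp hα hβ ha
    (fun j => Real.rpow_pos_of_pos (pnat_cast_pos j) _)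
    (fun j => Real.rpow_pos_of_pos (pnat_cast_pos j) _) hB ha' (L := 1)
    (C := 2 ^ (2 * s) + 2) one_pos (by positivity) fun y z hy hz => ?_
  set p := 2 * s + 2 * t + 1 / 2 with hp
  have hp0 : 0 < p := by positivity
  -- `D ≈ e^x`. The value `2y/p` balances `D^(-2s)` with `ε² D^(2t+1/2)`; the cap `z/t`, that is `D
  -- ≤ σ^(-1/t)`, keeps `σ² D^(2(t-s)₊)` within `σ^(2 min(s/t, 1))`.
  set x := min (2 * y / p) (z / t) with hx
  have hx0 : 0 ≤ x := le_min (by positivity) (by positivity)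
  obtain ⟨D, hD1, hD2, -⟩ := exists_pnat_floor (Real.one_le_exp hx0)
  have hD := pnat_cast_pos D
  have hpow : ∀ r : ℝ, 0 ≤ r → (D : ℝ) ^ r ≤ Real.exp (r * x) := fun r hr => by
    rw [mul_comm, Real.exp_mul]
    exact Real.rpow_le_rpow hD.le hD2 hr
  refine ⟨D, (D : ℝ) ^ (2 * t + 1 / 2), Real.exp (2 * max (t - s) 0 * x), by positivity,
    by positivity, sum_rpow_le t ht D, fun j hj => ?_, ?_⟩
  · have hj0 := pnat_cast_pos j
    have h1 : (j : ℝ) ^ (2 * (t - s)) ≤ Real.exp (2 * max (t - s) 0 * x) := by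
      calc (j : ℝ) ^ (2 * (t - s)) ≤ (j : ℝ) ^ (2 * max (t - s) 0) :=
            Real.rpow_le_rpow_of_exponent_le (one_le_pnat_cast j) (by gcongr; exact le_max_left _ _)
        _ ≤ (D : ℝ) ^ (2 * max (t - s) 0) :=
            Real.rpow_le_rpow hj0.le (pnat_cast_le hj) (by positivity)
        _ ≤ _ := hpow _ (by positivity)
    have h2 : ((j : ℝ) ^ s * (j : ℝ) ^ (-t)) ^ 2 = ((j : ℝ) ^ (2 * (t - s)))⁻¹ := by
      rw [← Real.rpow_add hj0, ← Real.rpow_mul_natCast hj0.le, ← Real.rpow_neg hj0.le]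
      congr 1; push_cast; ring
    rw [h2, ← div_eq_mul_inv, one_le_div (by positivity)]
    exact h1
  · rw [log_one_div_exp_neg]
    set E := Real.exp (-y) ^ (4 * s / p) with hE
    set F := (Real.exp (-z) * z ^ (3 / 4 : ℝ)) ^ (2 * min (s / t) 1) with hF
    have hEF1 : E ≤ max E F := le_max_left _ _
    have hEF2 : F ≤ max E F := le_max_right _ _
    have hE' : E = Real.exp (-(2 * s * (2 * y / p))) := by
      rw [hE, ← Real.exp_mul]; congr 1; ring
    have hF' : Real.exp (-(2 * s * (z / t))) ≤ F := by
      have := exp_neg_mul_le_rpow (γ := 3 / 4) (m := 2 * min (s / t) 1) (m' := 2 * (s / t)) hz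
        (by norm_num) (by positivity) (by gcongr; exact min_le_left _ _)
      refine le_trans (le_of_eq ?_) this
      congr 1; ring
    have h1 : (((D : ℝ) ^ s) ^ 2)⁻¹ ≤ 2 ^ (2 * s) * max E F := by
      have hx' : Real.exp (-(2 * s * x)) ≤ max E F := by
        rcases min_choice (2 * y / p) (z / t) with h | h
        · rw [hx, h, ← hE']; exact hEF1
        · rw [hx, h]; exact hF'.trans hEF2
      calc (((D : ℝ) ^ s) ^ 2)⁻¹ = ((D : ℝ) ^ (2 * s))⁻¹ := by
            rw [← Real.rpow_mul_natCast hD.le]; congr 2; push_cast; ring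
        _ ≤ ((Real.exp x / 2) ^ (2 * s))⁻¹ := by gcongr
        _ = 2 ^ (2 * s) * Real.exp (-(2 * s * x)) := by
            rw [Real.div_rpow (Real.exp_pos _).le zero_le_two, ← Real.exp_mul, inv_div,
              Real.exp_neg, div_eq_mul_inv, mul_comm x]
        _ ≤ _ := by gcongr
    have h2 : Real.exp (-y) ^ 2 * (D : ℝ) ^ (2 * t + 1 / 2) ≤ E := by
      calc Real.exp (-y) ^ 2 * (D : ℝ) ^ (2 * t + 1 / 2)
          ≤ Real.exp (-y) ^ 2 * Real.exp ((2 * t + 1 / 2) * (2 * y / p)) := by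
            gcongr
            refine (hpow _ (by positivity)).trans (Real.exp_le_exp.2 ?_)
            gcongr
            exact min_le_left _ _
        _ = E := by
            rw [hE', ← Real.exp_nat_mul, ← Real.exp_add]
            congr 1
            field_simp
            rw [hp]; push_cast; ring
    have h3 : Real.exp (-z) ^ 2 * Real.exp (2 * max (t - s) 0 * x) ≤ F :=
      exp_neg_sq_mul_exp_le hs ht hz (by norm_num) (min_le_right _ _)
    linarith

lemma hasUpperRate_rpow_exp (hα : 0 < α) (hβ : 0 < β) (hs : 0 < s) (ht : 0 < t)
    (ha : IsSmoothness a) (hB : EquivOn B fun j => (j : ℝ) ^ (-t))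
    (ha' : SeqEquiv a fun j => Real.exp (j * s)) :
    HasUpperRate a B α β fun ε σ =>
      max (ε ^ 2 * Real.log (1 / ε) ^ (2 * t + 1 / 2))
        (σ ^ 2 * Real.log (1 / σ) ^ (3 / 2 : ℝ)) := by
  refine hasUpperRate_of_exists_truncation_exp hα hβ ha
    (fun j => Real.rpow_pos_of_pos (pnat_cast_pos j) _) (fun j => Real.exp_pos _) hB ha'
    (L := max 1 s)
    (C := Real.exp (2 * s) + (s ^ (2 * t + 1 / 2))⁻¹ + ((t / s) ^ t) ^ 2)
    (by positivity) (by positivity) fun y z hy hz => ?_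
  have hy1 : 1 ≤ y := (le_max_left _ _).trans hy
  have hz1 : 1 ≤ z := (le_max_left _ _).trans hz
  -- `D ≈ y/s` brings the bias `e^(-2sD)` down to order `ε²`. It need not depend on `σ`: `e^(js)
  -- j^(-t)` is bounded below, so `Q` is a constant.
  obtain ⟨D, -, hD2, hD3⟩ := exists_pnat_floor ((one_le_div hs).2 ((le_max_right _ _).trans hy))
  have hD := pnat_cast_pos D
  refine ⟨D, (D : ℝ) ^ (2 * t + 1 / 2), ((t / s) ^ t) ^ 2, by positivity,
    by positivity, sum_rpow_le t ht D, fun j hj => ?_, ?_⟩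
  · have hj0 := pnat_cast_pos j
    rw [← mul_pow]
    refine one_le_pow₀ ?_
    have h := rpow_le_const_mul_exp ht (x := j * s) (by positivity)
    rw [Real.mul_rpow hj0.le hs.le] at h
    rw [Real.div_rpow ht.le hs.le, Real.rpow_neg hj0.le]
    have e : t ^ t / s ^ t * (Real.exp (j * s) * ((j : ℝ) ^ t)⁻¹) =
        t ^ t * Real.exp (j * s) / ((j : ℝ) ^ t * s ^ t) := by field_simp
    rw [e, one_le_div (by positivity)]
    exact h
  · rw [log_one_div_exp_neg, log_one_div_exp_neg]
    set E := Real.exp (-y) ^ 2 * y ^ (2 * t + 1 / 2) with hE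
    set F := Real.exp (-z) ^ 2 * z ^ (3 / 2 : ℝ) with hF
    have hEF1 : E ≤ max E F := le_max_left _ _
    have hEF2 : F ≤ max E F := le_max_right _ _
    have h1 : (Real.exp (D * s) ^ 2)⁻¹ ≤ Real.exp (2 * s) * max E F := by
      calc (Real.exp (D * s) ^ 2)⁻¹ = Real.exp (-(2 * (D * s))) := by
            rw [← Real.exp_nat_mul, ← Real.exp_neg]; congr 1
        _ ≤ Real.exp (2 * s) * Real.exp (-y) ^ 2 := by
            rw [← Real.exp_nat_mul, ← Real.exp_add]
            refine Real.exp_le_exp.2 ?_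
            have := mul_le_mul_of_nonneg_right hD3 hs.le
            rw [sub_mul, div_mul_cancel₀ _ hs.ne'] at this
            push_cast; linarith
        _ ≤ Real.exp (2 * s) * max E F := by
            gcongr
            refine le_trans (le_mul_of_one_le_right (by positivity) ?_) hEF1
            exact Real.one_le_rpow hy1 (by positivity)
    have h2 : Real.exp (-y) ^ 2 * (D : ℝ) ^ (2 * t + 1 / 2) ≤
        (s ^ (2 * t + 1 / 2))⁻¹ * max E F := by
      calc Real.exp (-y) ^ 2 * (D : ℝ) ^ (2 * t + 1 / 2)
          ≤ Real.exp (-y) ^ 2 * (y / s) ^ (2 * t + 1 / 2) := by gcongr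
        _ = (s ^ (2 * t + 1 / 2))⁻¹ * E := by
            rw [Real.div_rpow (by positivity) hs.le, hE]; ring
        _ ≤ _ := by gcongr
    have h3 : Real.exp (-z) ^ 2 * ((t / s) ^ t) ^ 2 ≤ ((t / s) ^ t) ^ 2 * max E F := by
      rw [mul_comm]
      gcongr
      refine le_trans (le_mul_of_one_le_right (by positivity) ?_) hEF2
      exact Real.one_le_rpow hz1 (by norm_num)
    linarith

lemma exp_neg_le_const_mul_rpow {p y : ℝ} (hp : 0 < p) (hy : 0 < y) :
    Real.exp (-y) ≤ p ^ p * y ^ (-p) := by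
  rw [Real.rpow_neg hy.le, ← div_eq_mul_inv, le_div_iff₀ (by positivity), Real.exp_neg,
    inv_mul_le_iff₀ (Real.exp_pos _), mul_comm]
  exact rpow_le_const_mul_exp hp hy.le

/-- The logarithm on the right is `z - (ln z) / 2`, which lies in `(0, z]` because `ln z ≤ z - 1`; a
nonpositive power reverses the order. -/
lemma rpow_neg_le_log_rpow_neg {p z : ℝ} (hp : 0 ≤ p) (hz : 1 ≤ z) :
    z ^ (-p) ≤ Real.log (1 / (Real.exp (-z) * z ^ (1 / 2 : ℝ))) ^ (-p) := by
  have hz0 : 0 < z := by linarith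
  have e : Real.log (1 / (Real.exp (-z) * z ^ (1 / 2 : ℝ))) = z - 1 / 2 * Real.log z := by
    rw [one_div, Real.log_inv, Real.log_mul (by positivity) (by positivity), Real.log_exp,
      Real.log_rpow hz0]
    ring
  have h1 := Real.log_nonneg hz
  have h2 := Real.log_le_sub_one_of_pos hz0
  rw [e, Real.rpow_neg hz0.le, Real.rpow_neg (by linarith)]
  have h3 : 0 < z - 1 / 2 * Real.log z := by linarith
  gcongr
  linarith

lemma hasUpperRate_exp_rpow (hα : 0 < α) (hβ : 0 < β) (hs : 0 < s) (ht : 0 < t)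
    (ha : IsSmoothness a) (hB : EquivOn B fun j => Real.exp (-(j * t)))
    (ha' : SeqEquiv a fun j => (j : ℝ) ^ s) :
    HasUpperRate a B α β fun ε σ =>
      max (Real.log (1 / ε) ^ (-(2 * s)))
        (Real.log (1 / (σ * Real.log (1 / σ) ^ (1 / 2 : ℝ))) ^ (-(2 * s))) := by
  set G := (√(1 - Real.exp (-(4 * t))))⁻¹ with hG
  have hG0 : 0 < G := by
    have : Real.exp (-(4 * t)) < 1 := by simpa using ht
    exact inv_pos.2 (Real.sqrt_pos.2 (by linarith))
  refine hasUpperRate_of_exists_truncation_exp hα hβ ha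
    (fun j => Real.exp_pos _) (fun j => Real.rpow_pos_of_pos (pnat_cast_pos j) _) hB ha'
    (L := max 1 (2 * t))
    (C := (4 * t) ^ (2 * s) + G * (2 * s) ^ (2 * s) + (2 * s) ^ (2 * s))
    (by positivity) (by positivity) fun y z hy hz => ?_
  have hy1 : 1 ≤ y := (le_max_left _ _).trans hy
  have hz1 : 1 ≤ z := (le_max_left _ _).trans hz
  have hx1 : 1 ≤ min y z / (2 * t) :=
    (one_le_div (by positivity)).2
      (le_min ((le_max_right _ _).trans hy) ((le_max_right _ _).trans hz))
  -- Half of the largest admissible order: with `e^(2tD) ≤ min (1/ε) (1/σ)`, the noise terms are of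
  -- order at most `ε` and `σ`, negligible against the logarithmic bias `D^(-2s)`.
  obtain ⟨D, hD1, hD2, -⟩ := exists_pnat_floor hx1
  have hD := pnat_cast_pos D
  have hDx : 2 * t * D ≤ min y z := by
    rw [le_div_iff₀ (by positivity)] at hD2; linarith
  refine ⟨D, G * Real.exp (2 * t * D), Real.exp (2 * t * D), by positivity,
    by positivity, sum_exp_le t ht D, fun j hj => ?_, ?_⟩
  · have hj0 := pnat_cast_pos j
    have hjD := pnat_cast_le hj
    have h1 : 1 ≤ ((j : ℝ) ^ s) ^ 2 := one_le_pow₀ (Real.one_le_rpow (one_le_pnat_cast j) hs.le)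
    have h2 : 1 ≤ Real.exp (2 * t * D) * Real.exp (-(j * t)) ^ 2 := by
      rw [← Real.exp_nat_mul, ← Real.exp_add]
      refine Real.one_le_exp ?_
      push_cast; nlinarith
    rw [mul_pow]
    calc (1 : ℝ) ≤ ((j : ℝ) ^ s) ^ 2 * (Real.exp (2 * t * D) * Real.exp (-(j * t)) ^ 2) :=
          one_le_mul_of_one_le_of_one_le h1 h2
      _ = _ := by ring
  · rw [log_one_div_exp_neg, log_one_div_exp_neg]
    set E := y ^ (-(2 * s)) with hE
    set F := Real.log (1 / (Real.exp (-z) * z ^ (1 / 2 : ℝ))) ^ (-(2 * s)) with hF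
    have hEF1 : E ≤ max E F := le_max_left _ _
    have hEF2 : F ≤ max E F := le_max_right _ _
    have hF' : z ^ (-(2 * s)) ≤ F := rpow_neg_le_log_rpow_neg (by positivity) hz1
    have hmin0 : 0 < min y z := lt_min (by linarith) (by linarith)
    have h1 : (((D : ℝ) ^ s) ^ 2)⁻¹ ≤ (4 * t) ^ (2 * s) * max E F := by
      calc (((D : ℝ) ^ s) ^ 2)⁻¹ = ((D : ℝ) ^ (2 * s))⁻¹ := by
            rw [← Real.rpow_mul_natCast hD.le]; congr 2; push_cast; ring
        _ ≤ ((min y z / (2 * t) / 2) ^ (2 * s))⁻¹ := by gcongr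
        _ = (4 * t) ^ (2 * s) * (min y z) ^ (-(2 * s)) := by
            have : min y z / (2 * t) / 2 = min y z / (4 * t) := by field_simp; norm_num
            rw [this, Real.div_rpow hmin0.le (by positivity), inv_div, Real.rpow_neg hmin0.le,
              div_eq_mul_inv]
        _ ≤ _ := by
            gcongr
            rcases min_choice y z with h | h
            · rw [h]; exact hEF1
            · rw [h]; exact hF'.trans hEF2
    have hsq : ∀ u : ℝ, 2 * t * D ≤ u → Real.exp (-u) ^ 2 * Real.exp (2 * t * D) ≤
        Real.exp (-u) := fun u hu => by
      rw [← Real.exp_nat_mul, ← Real.exp_add]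
      refine Real.exp_le_exp.2 ?_
      push_cast; linarith
    have h2 : Real.exp (-y) ^ 2 * (G * Real.exp (2 * t * D)) ≤
        G * (2 * s) ^ (2 * s) * max E F := by
      calc Real.exp (-y) ^ 2 * (G * Real.exp (2 * t * D))
          = G * (Real.exp (-y) ^ 2 * Real.exp (2 * t * D)) := by ring
        _ ≤ G * ((2 * s) ^ (2 * s) * max E F) := by
            refine mul_le_mul_of_nonneg_left ?_ hG0.le
            refine (hsq y (hDx.trans (min_le_left _ _))).trans
              ((exp_neg_le_const_mul_rpow (p := 2 * s) (by positivity) (by linarith)).trans ?_)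
            gcongr
        _ = _ := by ring
    have h3 : Real.exp (-z) ^ 2 * Real.exp (2 * t * D) ≤ (2 * s) ^ (2 * s) * max E F := by
      refine (hsq z (hDx.trans (min_le_right _ _))).trans
        ((exp_neg_le_const_mul_rpow (p := 2 * s) (by positivity) (by linarith)).trans ?_)
      gcongr
      exact hF'.trans hEF2
    linarith

lemma hasUpperRate_exp_exp (hα : 0 < α) (hβ : 0 < β) (hs : 0 < s) (ht : 0 < t)
    (ha : IsSmoothness a) (hB : EquivOn B fun j => Real.exp (-(j * t)))
    (ha' : SeqEquiv a fun j => Real.exp (j * s)) :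
    HasUpperRate a B α β fun ε σ =>
      max (ε ^ (2 * s / (s + t)))
        ((σ * Real.log (1 / σ) ^ (1 / 2 : ℝ)) ^ (2 * min (s / t) 1)) := by
  set G := (√(1 - Real.exp (-(4 * t))))⁻¹ with hG
  have hG0 : 0 < G := by
    have : Real.exp (-(4 * t)) < 1 := by simpa using ht
    exact inv_pos.2 (Real.sqrt_pos.2 (by linarith))
  refine hasUpperRate_of_exists_truncation_exp hα hβ ha
    (fun j => Real.exp_pos _) (fun j => Real.exp_pos _) hB ha' (L := max 1 (s + t))
    (C := Real.exp (2 * s) + G + 1) (by positivity) (by positivity) fun y z hy hz => ?_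
  have hy1 : 1 ≤ y := (le_max_left _ _).trans hy
  have hz1 : 1 ≤ z := (le_max_left _ _).trans hz
  -- `y/(s+t)` balances `e^(-2sD)` with `ε² e^(2tD)`; `z/t` limits the amplification of the noise in
  -- `X`.
  set x := min (y / (s + t)) (z / t) with hx
  have hx1 : 1 ≤ x := le_min ((one_le_div (by positivity)).2 ((le_max_right _ _).trans hy))
    ((one_le_div ht).2 (le_trans (by linarith) ((le_max_right _ _).trans hz)))
  obtain ⟨D, -, hD2, hD3⟩ := exists_pnat_floor hx1
  have hD := pnat_cast_pos D
  refine ⟨D, G * Real.exp (2 * t * D), Real.exp (2 * max (t - s) 0 * x), by positivity,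
    by positivity, sum_exp_le t ht D, fun j hj => ?_, ?_⟩
  · have hj0 := pnat_cast_pos j
    have hjx := (pnat_cast_le hj).trans hD2
    rw [← Real.exp_add, ← Real.exp_nat_mul, ← Real.exp_add]
    refine Real.one_le_exp ?_
    have h1 : (t - s) * j ≤ max (t - s) 0 * x :=
      mul_le_mul (le_max_left _ _) hjx hj0.le (le_max_right _ _)
    push_cast; nlinarith
  · rw [log_one_div_exp_neg]
    set E := Real.exp (-y) ^ (2 * s / (s + t)) with hE
    set F := (Real.exp (-z) * z ^ (1 / 2 : ℝ)) ^ (2 * min (s / t) 1) with hF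
    have hEF1 : E ≤ max E F := le_max_left _ _
    have hEF2 : F ≤ max E F := le_max_right _ _
    have hE' : E = Real.exp (-(2 * s * (y / (s + t)))) := by
      rw [hE, ← Real.exp_mul]; congr 1; ring
    have hF' : Real.exp (-(2 * s * (z / t))) ≤ F := by
      have := exp_neg_mul_le_rpow (γ := 1 / 2) (m := 2 * min (s / t) 1) (m' := 2 * (s / t)) hz1
        (by norm_num) (by positivity) (by gcongr; exact min_le_left _ _)
      refine le_trans (le_of_eq ?_) this
      congr 1; ring
    have h1 : (Real.exp (D * s) ^ 2)⁻¹ ≤ Real.exp (2 * s) * max E F := by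
      have hx' : Real.exp (-(2 * s * x)) ≤ max E F := by
        rcases min_choice (y / (s + t)) (z / t) with h | h
        · rw [hx, h, ← hE']; exact hEF1
        · rw [hx, h]; exact hF'.trans hEF2
      refine le_trans ?_ (mul_le_mul_of_nonneg_left hx' (Real.exp_pos _).le)
      rw [← Real.exp_nat_mul, ← Real.exp_neg, ← Real.exp_add]
      refine Real.exp_le_exp.2 ?_
      push_cast; nlinarith
    have h2 : Real.exp (-y) ^ 2 * (G * Real.exp (2 * t * D)) ≤ G * max E F := by
      have hDy : (D : ℝ) ≤ y / (s + t) := hD2.trans (min_le_left _ _)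
      calc Real.exp (-y) ^ 2 * (G * Real.exp (2 * t * D))
          ≤ Real.exp (-y) ^ 2 * (G * Real.exp (2 * t * (y / (s + t)))) := by gcongr
        _ = G * (Real.exp (-y) ^ 2 * Real.exp (2 * t * (y / (s + t)))) := by ring
        _ = G * E := by
            rw [hE', ← Real.exp_nat_mul, ← Real.exp_add]
            congr 2
            field_simp
            push_cast; ring
        _ ≤ _ := by gcongr
    have h3 : Real.exp (-z) ^ 2 * Real.exp (2 * max (t - s) 0 * x) ≤ F :=
      exp_neg_sq_mul_exp_le hs ht hz1 (by norm_num) (min_le_right _ _)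
    linarith

end rates

end GSM

end

/-- The set `B` holds the possible values of the unknown sequence `b`. A singleton `B = {b}` gives
the error probabilities at one fixed `b`; a larger `B` asks for one test that serves all its
members. -/
theorem theorem3 (α β : ℝ) (hα : α ∈ Set.Ioo (0 : ℝ) 1) (hβ : β ∈ Set.Ioo (0 : ℝ) 1)
    (s t : ℝ) (hs : 0 < s) (ht : 0 < t)
    (a : ℕ+ → ℝ) (ha : GSM.IsSmoothness a) (B : Set (ℕ+ → ℝ)) :
    (GSM.EquivOn B (fun j => (j : ℝ) ^ (-t)) → GSM.SeqEquiv a (fun j => (j : ℝ) ^ s) →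
      GSM.HasUpperRate a B α β fun ε σ =>
        max (ε ^ (4 * s / (2 * s + 2 * t + 1 / 2)))
          ((σ * Real.log (1 / σ) ^ (3 / 4 : ℝ)) ^ (2 * min (s / t) 1))) ∧
    (GSM.EquivOn B (fun j => (j : ℝ) ^ (-t)) → GSM.SeqEquiv a (fun j => Real.exp (j * s)) →
      GSM.HasUpperRate a B α β fun ε σ =>
        max (ε ^ 2 * Real.log (1 / ε) ^ (2 * t + 1 / 2))
          (σ ^ 2 * Real.log (1 / σ) ^ (3 / 2 : ℝ))) ∧
    (GSM.EquivOn B (fun j => Real.exp (-(j * t))) → GSM.SeqEquiv a (fun j => (j : ℝ) ^ s) →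
      GSM.HasUpperRate a B α β fun ε σ =>
        max (Real.log (1 / ε) ^ (-(2 * s)))
          (Real.log (1 / (σ * Real.log (1 / σ) ^ (1 / 2 : ℝ))) ^ (-(2 * s)))) ∧
    (GSM.EquivOn B (fun j => Real.exp (-(j * t))) → GSM.SeqEquiv a (fun j => Real.exp (j * s)) →
      GSM.HasUpperRate a B α β fun ε σ =>
        max (ε ^ (2 * s / (s + t)))
          ((σ * Real.log (1 / σ) ^ (1 / 2 : ℝ)) ^ (2 * min (s / t) 1))) := by
  exact ⟨GSM.hasUpperRate_rpow_rpow hα.1 hβ.1 hs ht ha, GSM.hasUpperRate_rpow_exp hα.1 hβ.1 hs ht ha,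
    GSM.hasUpperRate_exp_rpow hα.1 hβ.1 hs ht ha, GSM.hasUpperRate_exp_exp hα.1 hβ.1 hs ht ha⟩
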